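/- Let $G$ be a finite group. A rational $G$-Mackey functor $M$ consists of a $\mathbb{Q}$-module $M(G/H)$ for each subgroup $H \leqslant G$ together with $\mathbb{Q}$-linear restriction maps $R^H_K \colon M(G/H) \to M(G/K)$ and induction maps $I^H_K \colon M(G/K) \to M(G/H)$ for $K \leqslant H \leqslant G$, and conjugation maps $C_g \colon M(G/H) \to M(G/gHg^{-1})$ for $g \in G$, such that: 1. $R^H_H = \mathrm{id} = I^H_H$ for all $H \leqslant G$, and $C_h = \mathrm{id}$ on $M(G/H)$ for $h \in H$; 2. $I^H_L = I^H_K \circ I^K_L$ and $R^H_L = R^K_L \circ R^H_K$ for $L \leqslant K \leqslant H$, and $C_{gh} = C_g \circ C_h$ for $g, h \in G$; 3. $R^{gHg^{-1}}_{gKg^{-1}} \circ C_g = C_g \circ R^H_K$ and $I^{gHg^{-1}}_{gKg^{-1}} \circ C_g = C_g \circ I^H_K$ for $K \leqslant H$ and $g \in G$; 4. $R^H_K \circ I^H_L = \sum_{x} I^K_{K \cap xLx^{-1}} \circ C_x \circ R^L_{L \cap x^{-1}Kx}$ for $K, L \leqslant H$, where $x$ runs over any system of representatives in $H$ of the double cosets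 $K \backslash H / L$. A morphism $M \to N$ is a family of $\mathbb{Q}$-linear maps $M(G/H) \to N(G/H)$, $H \leqslant G$, commuting with all restriction, induction and conjugation maps. Then every rational $G$-Mackey functor is both a projective and an injective object of the category of rational $G$-Mackey functors. -/

import Mathlib

open CategoryTheory
open scoped Pointwise

universe u v

/-- `K ∩ x L x⁻¹ = x (L ∩ x⁻¹ K x) x⁻¹`, the identification of subgroups used in the
double coset formula. Here `MulAut.conj x • L` is the subgroup `x L x⁻¹`. -/
theorem inf_conj_smul_eq {G : Type u} [Group G] (K L : Subgroup G) (x : G) :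
    K ⊓ MulAut.conj x • L = MulAut.conj x • (L ⊓ MulAut.conj x⁻¹ • K) := by
  rw [Subgroup.smul_inf, smul_smul, ← map_mul, mul_inv_cancel, map_one, one_smul, inf_comm]

/-- A rational `G`-Mackey functor. The value `M(G/H)` is `obj H`; `res`, `ind` and `conj` are the
restriction `R^H_K`, the induction `I^H_K` and the conjugation `C_g : M(G/H) → M(G/gHg⁻¹)`.
So that equal subgroups need not be syntactically equal, the target of `conj g` is any
subgroup `H'` given with a proof that `H' = g H g⁻¹`. -/
structure RationalMackeyFunctor (G : Type u) [Group G] [Finite G] where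
  /-- the `ℚ`-module `M(G/H)` -/
  obj : Subgroup G → Type v
  [addCommGroup : ∀ H, AddCommGroup (obj H)]
  [module : ∀ H, Module ℚ (obj H)]
  /-- restriction `R^H_K` for `K ≤ H` -/
  res : ∀ {K H : Subgroup G}, K ≤ H → (obj H →ₗ[ℚ] obj K)
  /-- induction `I^H_K` for `K ≤ H` -/
  ind : ∀ {K H : Subgroup G}, K ≤ H → (obj K →ₗ[ℚ] obj H)
  /-- conjugation `C_g` -/
  conj : ∀ (g : G) {H H' : Subgroup G}, H' = MulAut.conj g • H → (obj H →ₗ[ℚ] obj H')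
  res_self : ∀ {H : Subgroup G} (h : H ≤ H) (m : obj H), res h m = m
  ind_self : ∀ {H : Subgroup G} (h : H ≤ H) (m : obj H), ind h m = m
  conj_self : ∀ {H : Subgroup G} (g : G) (_ : g ∈ H) (e : H = MulAut.conj g • H) (m : obj H),
    conj g e m = m
  ind_trans : ∀ {L K H : Subgroup G} (hLK : L ≤ K) (hKH : K ≤ H) (hLH : L ≤ H) (m : obj L),
    ind hLH m = ind hKH (ind hLK m)
  res_trans : ∀ {L K H : Subgroup G} (hLK : L ≤ K) (hKH : K ≤ H) (hLH : L ≤ H) (m : obj H),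
    res hLH m = res hLK (res hKH m)
  conj_mul : ∀ (g h : G) {H H' H'' : Subgroup G} (e : H' = MulAut.conj h • H)
    (e' : H'' = MulAut.conj g • H') (e'' : H'' = MulAut.conj (g * h) • H) (m : obj H),
    conj (g * h) e'' m = conj g e' (conj h e m)
  res_conj : ∀ (g : G) {K H K' H' : Subgroup G} (hKH : K ≤ H) (hKH' : K' ≤ H')
    (eK : K' = MulAut.conj g • K) (eH : H' = MulAut.conj g • H) (m : obj H),
    res hKH' (conj g eH m) = conj g eK (res hKH m)
  ind_conj : ∀ (g : G) {K H K' H' : Subgroup G} (hKH : K ≤ H) (hKH' : K' ≤ H')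
    (eK : K' = MulAut.conj g • K) (eH : H' = MulAut.conj g • H) (m : obj K),
    ind hKH' (conj g eK m) = conj g eH (ind hKH m)
  /-- The Mackey axiom: for `K, L ≤ H` and every system `σ` of representatives of `K \ H / L`,
  `R^H_K ∘ I^H_L = ∑ x, I^K_{K ∩ x L x⁻¹} ∘ C_x ∘ R^L_{L ∩ x⁻¹ K x}`.
  (The sum is finite because `G` is.) -/
  mackey : ∀ {K L H : Subgroup G} (hK : K ≤ H) (hL : L ≤ H)
    (σ : DoubleCoset.Quotient (K.subgroupOf H : Set H) (L.subgroupOf H : Set H) → H)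
    (_ : ∀ q, DoubleCoset.mk (K.subgroupOf H) (L.subgroupOf H) (σ q) = q) (m : obj L),
    res hK (ind hL m) =
      ∑ᶠ q, ind (inf_le_left : K ⊓ MulAut.conj (σ q : G) • L ≤ K)
        (conj (σ q : G) (inf_conj_smul_eq K L (σ q : G))
          (res (inf_le_left : L ⊓ MulAut.conj (σ q : G)⁻¹ • K ≤ L) m))

namespace RationalMackeyFunctor

attribute [instance] RationalMackeyFunctor.addCommGroup RationalMackeyFunctor.module

variable {G : Type u} [Group G] [Finite G]

/-- A morphism of rational Mackey functors: a family of `ℚ`-linear maps commuting with all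
restriction, induction and conjugation maps. -/
@[ext]
structure Hom (M N : RationalMackeyFunctor.{u, v} G) where
  app : ∀ H : Subgroup G, M.obj H →ₗ[ℚ] N.obj H
  app_res : ∀ {K H : Subgroup G} (h : K ≤ H) (m : M.obj H),
    app K (M.res h m) = N.res h (app H m)
  app_ind : ∀ {K H : Subgroup G} (h : K ≤ H) (m : M.obj K),
    app H (M.ind h m) = N.ind h (app K m)
  app_conj : ∀ (g : G) {H H' : Subgroup G} (e : H' = MulAut.conj g • H) (m : M.obj H),
    app H' (M.conj g e m) = N.conj g e (app H m)

/-- The category of rational `G`-Mackey functors. -/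
instance category : Category (RationalMackeyFunctor.{u, v} G) where
  Hom M N := Hom M N
  id M :=
    { app := fun _ => LinearMap.id
      app_res := fun _ _ => rfl
      app_ind := fun _ _ => rfl
      app_conj := fun _ _ _ _ _ => rfl }
  comp f g :=
    { app := fun H => (g.app H).comp (f.app H)
      app_res := fun h m => by simp [f.app_res, g.app_res]
      app_ind := fun h m => by simp [f.app_ind, g.app_ind]
      app_conj := fun a _ _ e m => by simp [f.app_conj, g.app_conj] }

end RationalMackeyFunctor

/-!
The category is von Neumann regular: every morphism `f` has some `s` with `f ≫ s ≫ f = f`, so all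
epimorphisms and all monomorphisms split.

The modules are rational, so the Mackey axiom may be averaged over `H` and no double coset
representatives are left. If a family of linear maps `u_K : X(G/K) → E(G/K)` commutes with
conjugation, has all its values killed by proper restrictions, and kills everything induced from
proper subgroups, then every term of the averaged formula with a proper intersection drops out,
and the transfer `∑_{K ≤ H} |K| / |H| • I^H_K ∘ u_K ∘ R^H_K` is a morphism. Every morphism arises
in this way: by induction on `n`, a morphism agrees on subgroups of order less than `n` with a
transfer, and the difference of the two at the subgroups of order `n` is again such a family.

Let `a`, `p` and `r` be families whose transfers are `f`, `𝟙 E` and `𝟙 X`. Linear pseudo-inverses of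
the `a_K` exist over a field and can be averaged over `G` to a conjugation-equivariant family `t`
with `a ∘ t ∘ a = a`; the transfer of `p ∘ t ∘ r` is then the required `s`.
-/

section DoubleCoset

variable {A : Type*} [Group A]

theorem card_doubleCoset_mul_card_inf_conj_smul (L K : Subgroup A) (x : A) :
    Nat.card (DoubleCoset.doubleCoset x (L : Set A) K) *
      Nat.card (L ⊓ MulAut.conj x • K : Subgroup A) = Nat.card L * Nat.card K := by
  have orbit_eq : ((↑) : A → A ⧸ K) '' ((L : Set A) * {x}) = MulAction.orbit L (x : A ⧸ K) := by
    ext y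
    constructor
    · rintro ⟨_, ⟨l, hl, _, rfl, rfl⟩, rfl⟩
      exact ⟨⟨l, hl⟩, rfl⟩
    · rintro ⟨l, rfl⟩
      exact ⟨l * x, Set.mul_mem_mul l.2 rfl, rfl⟩
  have stabilizer_eq :
      MulAction.stabilizer L (x : A ⧸ K) = (L ⊓ MulAut.conj x • K).subgroupOf L := by
    ext l
    have smul_coset : l • (x : A ⧸ K) = ((l * x : A) : A ⧸ K) := rfl
    rw [MulAction.mem_stabilizer_iff, eq_comm, smul_coset, QuotientGroup.eq,
      Subgroup.inf_subgroupOf_left, Subgroup.mem_subgroupOf,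
      Subgroup.mem_pointwise_smul_iff_inv_smul_mem, ← map_inv, MulAut.smul_def,
      MulAut.conj_apply, inv_inv, mul_assoc]
  have card_stabilizer : Nat.card (MulAction.stabilizer L (x : A ⧸ K)) =
      Nat.card (L ⊓ MulAut.conj x • K : Subgroup A) := by
    rw [stabilizer_eq]
    exact Nat.card_congr (Subgroup.subgroupOfEquivOfLe inf_le_left).toEquiv
  have orbit_stabilizer := (MulAction.stabilizer L (x : A ⧸ K)).card_mul_index
  rw [MulAction.index_stabilizer, card_stabilizer, ← orbit_eq] at orbit_stabilizer
  rw [DoubleCoset.doubleCoset, Subgroup.card_mul_eq_card_subgroup_mul_card_quotient,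
    ← orbit_stabilizer, Nat.card_coe_set_eq]
  ring

theorem card_doubleCoset_subgroupOf_mul_card_inf_conj_smul {K L H : Subgroup A} (hK : K ≤ H)
    (hL : L ≤ H) (x : H) :
    Nat.card (DoubleCoset.doubleCoset x (K.subgroupOf H : Set H) (L.subgroupOf H)) *
      Nat.card (K ⊓ MulAut.conj (x : A) • L : Subgroup A) = Nat.card K * Nat.card L := by
  have card_subgroupOf {J : Subgroup A} (hJ : J ≤ H) : Nat.card (J.subgroupOf H) = Nat.card J :=
    Nat.card_congr (Subgroup.subgroupOfEquivOfLe hJ).toEquiv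
  rw [← card_subgroupOf hK, ← card_subgroupOf hL, ← card_subgroupOf (inf_le_left.trans hK),
    ← card_doubleCoset_mul_card_inf_conj_smul _ _ x, Subgroup.conj_smul_subgroupOf hL]
  rfl

theorem sum_eq_finsum_card_doubleCoset_nsmul [Fintype A] {V : Type*} [AddCommMonoid V]
    {L K : Subgroup A} {σ : DoubleCoset.Quotient (L : Set A) (K : Set A) → A}
    (hσ : ∀ q, DoubleCoset.mk L K (σ q) = q) (f : A → V)
    (hf : ∀ x, ∀ l ∈ L, ∀ k ∈ K, f (l * x * k) = f x) :
    ∑ x, f x =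
      ∑ᶠ q, Nat.card (DoubleCoset.doubleCoset (σ q) (L : Set A) K) • f (σ q) := by
  classical
  have : Finite (DoubleCoset.Quotient (L : Set A) (K : Set A)) := Quotient.finite _
  have := Fintype.ofFinite (DoubleCoset.Quotient (L : Set A) (K : Set A))
  have mk_eq_iff (q) (x : A) : DoubleCoset.mk L K x = q ↔
      x ∈ DoubleCoset.doubleCoset (σ q) (L : Set A) K := by
    have mk_eq_comm : DoubleCoset.mk L K x = q ↔
        DoubleCoset.mk L K (σ q) = DoubleCoset.mk L K x := by rw [hσ, eq_comm]
    rw [mk_eq_comm, DoubleCoset.eq, DoubleCoset.mem_doubleCoset]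
    rfl
  rw [finsum_eq_sum_of_fintype, ← Finset.sum_fiberwise Finset.univ (DoubleCoset.mk L K)]
  refine Finset.sum_congr rfl fun q _ => ?_
  have f_eq : ∀ x ∈ Finset.univ.filter (DoubleCoset.mk L K · = q), f x = f (σ q) := by
    intro x hx
    obtain ⟨l, hl, k, hk, rfl⟩ :=
      DoubleCoset.mem_doubleCoset.1 ((mk_eq_iff q x).1 (Finset.mem_filter.1 hx).2)
    exact hf _ l hl k hk
  rw [Finset.sum_congr rfl f_eq, Finset.sum_const, Nat.card_eq_fintype_card, Fintype.card_subtype]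
  simp only [mk_eq_iff]

end DoubleCoset

theorem card_conj_smul {A : Type*} [Group A] (g : A) (K : Subgroup A) :
    Nat.card (MulAut.conj g • K : Subgroup A) = Nat.card K :=
  (Nat.card_congr (Subgroup.equivSMul (MulAut.conj g) K).toEquiv).symm

theorem conj_smul_le_iff_of_mem {A : Type*} [Group A] {g : A} {K H : Subgroup A} (hg : g ∈ H) :
    MulAut.conj g • K ≤ H ↔ K ≤ H := by
  conv_lhs => rw [← Subgroup.conj_smul_eq_self_of_mem hg]
  exact Subgroup.pointwise_smul_le_pointwise_smul_iff

theorem card_subgroup_lt_card_of_lt {A : Type*} [Group A] [Finite A] {K H : Subgroup A}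
    (h : K < H) :
    Nat.card K < Nat.card H :=
  Set.ncard_lt_ncard (SetLike.coe_ssubset_coe.2 h)

theorem exists_linearMap_comp_comp_eq_self {k V W : Type*} [DivisionRing k] [AddCommGroup V]
    [Module k V] [AddCommGroup W] [Module k W] (f : V →ₗ[k] W) :
    ∃ s : W →ₗ[k] V, f ∘ₗ s ∘ₗ f = f := by
  obtain ⟨t, ht⟩ := f.rangeRestrict.exists_rightInverse_of_surjective f.range_rangeRestrict
  obtain ⟨s, hs⟩ := LinearMap.exists_extend t
  refine ⟨s, LinearMap.ext fun v => ?_⟩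
  have s_apply : s (f v) = t (f.rangeRestrict v) := LinearMap.congr_fun hs (f.rangeRestrict v)
  have f_t := congrArg Subtype.val (LinearMap.congr_fun ht (f.rangeRestrict v))
  simpa [s_apply] using f_t

theorem projective_of_forall_exists_comp_comp_eq_self {C : Type*} [Category* C]
    (regular : ∀ {X Y : C} (f : X ⟶ Y), ∃ s : Y ⟶ X, f ≫ s ≫ f = f) (P : C) :
    Projective P where
  factors f e _ := by
    obtain ⟨s, hs⟩ := regular e
    have : s ≫ e = 𝟙 _ := by rw [← cancel_epi e, hs, Category.comp_id]
    exact ⟨f ≫ s, by rw [Category.assoc, this, Category.comp_id]⟩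

theorem injective_of_forall_exists_comp_comp_eq_self {C : Type*} [Category* C]
    (regular : ∀ {X Y : C} (f : X ⟶ Y), ∃ s : Y ⟶ X, f ≫ s ≫ f = f) (I : C) :
    Injective I where
  factors g i _ := by
    obtain ⟨s, hs⟩ := regular i
    have : i ≫ s = 𝟙 _ := by rw [← cancel_mono i, Category.assoc, hs, Category.id_comp]
    exact ⟨s ≫ g, by rw [← Category.assoc, this, Category.id_comp]⟩

namespace RationalMackeyFunctor

attribute [local instance] Fintype.ofFinite

noncomputable section

variable {G : Type u} [Group G] [Finite G]

section AveragedMackey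

variable {M : RationalMackeyFunctor.{u, v} G} {K L H : Subgroup G}

variable (M K L) in
/-- The summand `I^K_{K ∩ x L x⁻¹} ∘ C_x ∘ R^L_{L ∩ x⁻¹ K x}` of the double coset formula. -/
def mackeyTerm (x : G) : M.obj L →ₗ[ℚ] M.obj K :=
  M.ind inf_le_left ∘ₗ M.conj x (inf_conj_smul_eq K L x) ∘ₗ M.res inf_le_left

theorem mackeyTerm_apply_of_eq {x : G} {J J' : Subgroup G} (hJ : J = L ⊓ MulAut.conj x⁻¹ • K)
    (hJL : J ≤ L) (hJK : J' ≤ K) (e : J' = MulAut.conj x • J) (m : M.obj L) :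
    M.mackeyTerm K L x m = M.ind hJK (M.conj x e (M.res hJL m)) := by
  obtain rfl : J' = K ⊓ MulAut.conj x • L := by rw [e, hJ, ← inf_conj_smul_eq]
  subst hJ
  rfl

theorem mackeyTerm_apply_of_conj_smul_le {x : G} (hx : MulAut.conj x • L ≤ K) (m : M.obj L) :
    M.mackeyTerm K L x m = M.ind hx (M.conj x rfl m) := by
  have hJ : L = L ⊓ MulAut.conj x⁻¹ • K := by
    rwa [eq_comm, inf_eq_left, map_inv, ← Subgroup.pointwise_smul_subset_iff]
  rw [mackeyTerm_apply_of_eq hJ le_rfl hx rfl, M.res_self]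

theorem mackeyTerm_apply_of_le_conj_smul {x : G} {J : Subgroup G} (eK : K = MulAut.conj x • J)
    (hJ : J ≤ L) (m : M.obj L) :
    M.mackeyTerm K L x m = M.conj x eK (M.res hJ m) := by
  have hJ' : J = L ⊓ MulAut.conj x⁻¹ • K := by
    rw [eK, map_inv, inv_smul_smul, inf_eq_right.2 hJ]
  rw [mackeyTerm_apply_of_eq hJ' hJ le_rfl eK, M.ind_self]

theorem mackeyTerm_mul_left {k : G} (hk : k ∈ K) (x : G) (m : M.obj L) :
    M.mackeyTerm K L (k * x) m = M.mackeyTerm K L x m := by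
  have eK : K = MulAut.conj k • K := (Subgroup.conj_smul_eq_self_of_mem hk).symm
  have hJ : L ⊓ MulAut.conj x⁻¹ • K = L ⊓ MulAut.conj (k * x)⁻¹ • K := by
    rw [mul_inv_rev, map_mul, mul_smul, Subgroup.conj_smul_eq_self_of_mem (K.inv_mem hk)]
  have hkJ : MulAut.conj k • (K ⊓ MulAut.conj x • L) ≤ K :=
    (Subgroup.pointwise_smul_le_pointwise_smul_iff.2 inf_le_left).trans eK.ge
  have e : MulAut.conj k • (K ⊓ MulAut.conj x • L) =
      MulAut.conj (k * x) • (L ⊓ MulAut.conj x⁻¹ • K) := by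
    rw [inf_conj_smul_eq, map_mul, mul_smul]
  rw [mackeyTerm_apply_of_eq hJ inf_le_left hkJ e, M.conj_mul k x (inf_conj_smul_eq K L x) rfl,
    M.ind_conj k inf_le_left hkJ rfl eK, M.conj_self k hk]
  rfl

theorem mackeyTerm_mul_right {l : G} (hl : l ∈ L) (x : G) (m : M.obj L) :
    M.mackeyTerm K L (x * l) m = M.mackeyTerm K L x m := by
  have eL : L = MulAut.conj l • L := (Subgroup.conj_smul_eq_self_of_mem hl).symm
  have hJ : MulAut.conj l⁻¹ • (L ⊓ MulAut.conj x⁻¹ • K) = L ⊓ MulAut.conj (x * l)⁻¹ • K := by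
    rw [Subgroup.smul_inf, Subgroup.conj_smul_eq_self_of_mem (L.inv_mem hl), mul_inv_rev, map_mul,
      mul_smul]
  have hJL : MulAut.conj l⁻¹ • (L ⊓ MulAut.conj x⁻¹ • K) ≤ L := hJ.trans_le inf_le_left
  have el : L ⊓ MulAut.conj x⁻¹ • K =
      MulAut.conj l • MulAut.conj l⁻¹ • (L ⊓ MulAut.conj x⁻¹ • K) := by
    rw [map_inv _ l, smul_inv_smul]
  have e : K ⊓ MulAut.conj x • L =
      MulAut.conj (x * l) • MulAut.conj l⁻¹ • (L ⊓ MulAut.conj x⁻¹ • K) := by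
    rw [map_mul, mul_smul, ← el, inf_conj_smul_eq]
  rw [mackeyTerm_apply_of_eq hJ hJL inf_le_left e, M.conj_mul x l el (inf_conj_smul_eq K L x),
    ← M.res_conj l hJL inf_le_left el eL, M.conj_self l hl]
  rfl

/-- A system of representatives is traded for a sum over all of `H`: the double coset `K x L` has
`|K| |L| / |K ∩ x L x⁻¹|` elements. -/
theorem card_mul_card_nsmul_res_ind (hK : K ≤ H) (hL : L ≤ H) (m : M.obj L) :
    (Nat.card K * Nat.card L) • M.res hK (M.ind hL m) =
      ∑ x : H, Nat.card (K ⊓ MulAut.conj (x : G) • L : Subgroup G) • M.mackeyTerm K L x m := by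
  let σ : DoubleCoset.Quotient (K.subgroupOf H : Set H) (L.subgroupOf H : Set H) → H :=
    Quotient.out
  have hσ (q) : DoubleCoset.mk (K.subgroupOf H) (L.subgroupOf H) (σ q) = q := Quotient.out_eq q
  have : Finite (DoubleCoset.Quotient (K.subgroupOf H : Set H) (L.subgroupOf H : Set H)) :=
    Quotient.finite _
  rw [sum_eq_finsum_card_doubleCoset_nsmul hσ, M.mackey hK hL σ hσ, smul_finsum' _ (Set.toFinite _)]
  · refine finsum_congr fun q => ?_
    rw [smul_smul, card_doubleCoset_subgroupOf_mul_card_inf_conj_smul hK hL]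
    rfl
  · intro x k hk l hl
    rw [Subgroup.mem_subgroupOf] at hk hl
    have inf_eq : K ⊓ MulAut.conj ((k * x * l : H) : G) • L =
        MulAut.conj (k : G) • (K ⊓ MulAut.conj (x : G) • L) := by
      rw [Subgroup.smul_inf, Subgroup.conj_smul_eq_self_of_mem hk, Subgroup.coe_mul,
        Subgroup.coe_mul, map_mul, map_mul, mul_smul, mul_smul,
        Subgroup.conj_smul_eq_self_of_mem hl]
    rw [inf_eq, card_conj_smul, Subgroup.coe_mul, Subgroup.coe_mul,
      mackeyTerm_mul_right hl, mackeyTerm_mul_left hk]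

end AveragedMackey

section Transfer

variable {X E : RationalMackeyFunctor.{u, v} G} {K L H : Subgroup G}

open Classical in
/-- The summand `I^H_K ∘ u_K ∘ R^H_K` of the transfer, extended by `0` to the subgroups `K` that
are not contained in `H`. -/
def transferTerm (u : ∀ K, X.obj K →ₗ[ℚ] E.obj K) (H K : Subgroup G) : X.obj H →ₗ[ℚ] E.obj H :=
  if h : K ≤ H then E.ind h ∘ₗ u K ∘ₗ X.res h else 0

/-- The transfer of a family `u`, with components `∑_{K ≤ H} |K| / |H| • I^H_K ∘ u_K ∘ R^H_K`. If
`u` commutes with conjugation, each conjugacy class of `K` contributes with the total weight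
`|H : N_H(K)| |K| / |H| = 1 / |N_H(K) : K|`. -/
def transfer (u : ∀ K, X.obj K →ₗ[ℚ] E.obj K) (H : Subgroup G) : X.obj H →ₗ[ℚ] E.obj H :=
  (Nat.card H : ℚ)⁻¹ • ∑ K : Subgroup G, Nat.card K • transferTerm u H K

/-- The families of linear maps `X(G/K) → E(G/K)` that commute with conjugation, with no condition
on restriction and induction. -/
structure IsEquivariant (u : ∀ K, X.obj K →ₗ[ℚ] E.obj K) : Prop where
  conj_apply : ∀ (g : G) {K K' : Subgroup G} (e : K' = MulAut.conj g • K) (m : X.obj K),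
    E.conj g e (u K m) = u K' (X.conj g e m)

/-- The equivariant families that take values in the elements with zero proper restrictions and
vanish on the elements induced from proper subgroups, so that their transfer is a morphism. -/
structure IsCuspidal (u : ∀ K, X.obj K →ₗ[ℚ] E.obj K) : Prop extends IsEquivariant u where
  res_apply : ∀ {J K : Subgroup G} (h : J < K) (m : X.obj K), E.res h.le (u K m) = 0
  apply_ind : ∀ {J K : Subgroup G} (h : J < K) (m : X.obj J), u K (X.ind h.le m) = 0

variable {u : ∀ K, X.obj K →ₗ[ℚ] E.obj K}

theorem transferTerm_apply_of_le (h : K ≤ H) (m : X.obj H) :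
    transferTerm u H K m = E.ind h (u K (X.res h m)) := by
  simp [transferTerm, h]

theorem transferTerm_of_not_le (h : ¬K ≤ H) : transferTerm u H K = 0 := by
  simp [transferTerm, h]

theorem transferTerm_self_apply (m : X.obj H) : transferTerm u H H m = u H m := by
  rw [transferTerm_apply_of_le le_rfl, X.res_self, E.ind_self]

theorem card_nsmul_transfer_apply (u : ∀ K, X.obj K →ₗ[ℚ] E.obj K) (m : X.obj H) :
    Nat.card H • transfer u H m = ∑ K : Subgroup G, Nat.card K • transferTerm u H K m := by
  have card_ne_zero : (Nat.card H : ℚ) ≠ 0 := by exact_mod_cast Nat.card_pos.ne'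
  rw [transfer, ← Nat.cast_smul_eq_nsmul ℚ, LinearMap.smul_apply, smul_inv_smul₀ card_ne_zero]
  simp only [LinearMap.sum_apply, LinearMap.smul_apply]

theorem eq_of_card_nsmul_eq {V : Type*} [AddCommGroup V] [Module ℚ V] (H : Subgroup G) {m n : V}
    (h : Nat.card H • m = Nat.card H • n) : m = n :=
  have := IsAddTorsionFree.of_module_rat V
  nsmul_right_injective Nat.card_pos.ne' h

theorem map_transfer_apply_of_forall_lt {V : Type*} [AddCommGroup V] [Module ℚ V]
    (φ : E.obj H →ₗ[ℚ] V) {m : X.obj H}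
    (h : ∀ K (hK : K < H), φ (E.ind hK.le (u K (X.res hK.le m))) = 0) :
    φ (transfer u H m) = φ (u H m) := by
  refine eq_of_card_nsmul_eq H ?_
  rw [← map_nsmul, card_nsmul_transfer_apply, map_sum, Finset.sum_eq_single H _ (by simp),
    transferTerm_self_apply, map_nsmul]
  intro K _ hKH
  by_cases hK : K ≤ H
  · rw [transferTerm_apply_of_le hK, map_nsmul, h K (hK.lt_of_ne hKH), smul_zero]
  · rw [transferTerm_of_not_le hK, LinearMap.zero_apply, smul_zero, map_zero]

theorem transfer_add (u w : ∀ K, X.obj K →ₗ[ℚ] E.obj K) (H : Subgroup G) :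
    transfer (u + w) H = transfer u H + transfer w H := by
  have transferTerm_add (K : Subgroup G) :
      transferTerm (u + w) H K = transferTerm u H K + transferTerm w H K := by
    by_cases h : K ≤ H
    · ext m
      simp [transferTerm_apply_of_le h]
    · simp [transferTerm_of_not_le h]
  simp only [transfer, transferTerm_add, smul_add, Finset.sum_add_distrib]

theorem app_transfer_app {Y F : RationalMackeyFunctor.{u, v} G} (f : Hom E F) (g : Hom Y X)
    (u : ∀ K, X.obj K →ₗ[ℚ] E.obj K) (H : Subgroup G) (m : Y.obj H) :
    f.app H (transfer u H (g.app H m)) =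
      transfer (fun K => f.app K ∘ₗ u K ∘ₗ g.app K) H m := by
  refine eq_of_card_nsmul_eq H ?_
  rw [← map_nsmul, card_nsmul_transfer_apply, card_nsmul_transfer_apply, map_sum]
  refine Finset.sum_congr rfl fun K _ => ?_
  by_cases hK : K ≤ H
  · simp only [map_nsmul, transferTerm_apply_of_le hK, f.app_ind, g.app_res, LinearMap.comp_apply]
  · simp [transferTerm_of_not_le hK]

theorem sum_card_nsmul_conj_smul {V : Type*} [AddCommMonoid V] (g : G) (f : Subgroup G → V) :
    ∑ K : Subgroup G, Nat.card K • f (MulAut.conj g • K) = ∑ K : Subgroup G, Nat.card K • f K := by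
  rw [← Equiv.sum_comp (MulAction.toPerm (MulAut.conj g)) fun K : Subgroup G => Nat.card K • f K]
  simp only [MulAction.toPerm_apply, card_conj_smul]

theorem nsmul_sum_card_nsmul_eq {V ι : Type*} [AddCommMonoid V] [Fintype ι] {n : ℕ} (g : ι → G)
    {a b : Subgroup G → V} (h : ∀ K, n • a K = ∑ i, b (MulAut.conj (g i) • K)) :
    n • ∑ K : Subgroup G, Nat.card K • a K =
      Fintype.card ι • ∑ K : Subgroup G, Nat.card K • b K := by
  calc n • ∑ K : Subgroup G, Nat.card K • a K
      = ∑ i, ∑ K : Subgroup G, Nat.card K • b (MulAut.conj (g i) • K) := by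
        simp only [Finset.smul_sum, smul_comm n, h]
        exact Finset.sum_comm
    _ = Fintype.card ι • ∑ K : Subgroup G, Nat.card K • b K := by
        simp only [sum_card_nsmul_conj_smul, Finset.sum_const, Finset.card_univ]

namespace IsEquivariant

theorem conj_transferTerm (hu : IsEquivariant u) {g : G} {H' : Subgroup G}
    (eH : H' = MulAut.conj g • H) (m : X.obj H) :
    E.conj g eH (transferTerm u H K m) =
      transferTerm u H' (MulAut.conj g • K) (X.conj g eH m) := by
  have le_iff : MulAut.conj g • K ≤ H' ↔ K ≤ H := by
    rw [eH, Subgroup.pointwise_smul_le_pointwise_smul_iff]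
  by_cases h : K ≤ H
  · rw [transferTerm_apply_of_le h, transferTerm_apply_of_le (le_iff.2 h),
      X.res_conj g h (le_iff.2 h) rfl eH, ← hu.conj_apply,
      E.ind_conj g h (le_iff.2 h) rfl eH]
  · rw [transferTerm_of_not_le h, transferTerm_of_not_le (le_iff.not.2 h)]
    simp only [LinearMap.zero_apply, map_zero]

theorem conj_transfer (hu : IsEquivariant u) (g : G) {H' : Subgroup G}
    (eH : H' = MulAut.conj g • H) (m : X.obj H) :
    E.conj g eH (transfer u H m) = transfer u H' (X.conj g eH m) := by
  have card_eq : Nat.card H' = Nat.card H := by rw [eH, card_conj_smul]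
  refine eq_of_card_nsmul_eq H ?_
  rw [← map_nsmul, card_nsmul_transfer_apply, ← card_eq, card_nsmul_transfer_apply,
    ← sum_card_nsmul_conj_smul g
      fun K => transferTerm u H' K (X.conj g eH m), map_sum]
  simp only [map_nsmul, hu.conj_transferTerm]

end IsEquivariant

namespace IsCuspidal

theorem add {w : ∀ K, X.obj K →ₗ[ℚ] E.obj K} (hu : IsCuspidal u) (hw : IsCuspidal w) :
    IsCuspidal (u + w) where
  conj_apply g _ _ e m := by simp [hu.conj_apply, hw.conj_apply]
  res_apply h m := by simp [hu.res_apply h, hw.res_apply h]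
  apply_ind h m := by simp [hu.apply_ind h, hw.apply_ind h]

theorem card_inf_nsmul_mackeyTerm_apply (hu : IsCuspidal u) (hL : L ≤ H) (hK : K ≤ H) (x : H)
    (m : X.obj H) :
    Nat.card (L ⊓ MulAut.conj (x : G) • K : Subgroup G) •
        E.mackeyTerm L K x (u K (X.res hK m)) =
      Nat.card K • transferTerm u L (MulAut.conj (x : G) • K) (X.res hL m) := by
  have eH : H = MulAut.conj (x : G) • H := (Subgroup.conj_smul_eq_self_of_mem x.2).symm
  by_cases hx : MulAut.conj (x : G) • K ≤ L
  · rw [inf_eq_right.2 hx, card_conj_smul, mackeyTerm_apply_of_conj_smul_le hx, hu.conj_apply,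
      ← X.res_conj x hK (hx.trans hL) rfl eH, X.conj_self x x.2, transferTerm_apply_of_le hx,
      ← X.res_trans hx hL (hx.trans hL)]
  · have inf_lt : K ⊓ MulAut.conj (x : G)⁻¹ • L < K := by
      rw [inf_lt_left, map_inv, ← Subgroup.pointwise_smul_subset_iff]
      exact hx
    rw [mackeyTerm, LinearMap.comp_apply, LinearMap.comp_apply, hu.res_apply inf_lt,
      transferTerm_of_not_le hx]
    simp only [map_zero, smul_zero, LinearMap.zero_apply]

theorem card_nsmul_res_transferTerm (hu : IsCuspidal u) (hL : L ≤ H) (K : Subgroup G)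
    (m : X.obj H) :
    Nat.card L • E.res hL (transferTerm u H K m) =
      ∑ x : H, transferTerm u L (MulAut.conj (x : G) • K) (X.res hL m) := by
  by_cases hK : K ≤ H
  · refine eq_of_card_nsmul_eq K ?_
    rw [smul_smul, mul_comm, transferTerm_apply_of_le hK, card_mul_card_nsmul_res_ind hL hK,
      Finset.smul_sum]
    exact Finset.sum_congr rfl fun x _ => hu.card_inf_nsmul_mackeyTerm_apply hL hK x m
  · have not_le (x : H) : ¬MulAut.conj (x : G) • K ≤ L := fun h =>
      hK ((conj_smul_le_iff_of_mem x.2).1 (h.trans hL))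
    simp only [transferTerm_of_not_le hK, transferTerm_of_not_le (not_le _), LinearMap.zero_apply,
      map_zero, smul_zero, Finset.sum_const_zero]

theorem res_transfer (hu : IsCuspidal u) (hL : L ≤ H) (m : X.obj H) :
    E.res hL (transfer u H m) = transfer u L (X.res hL m) := by
  refine eq_of_card_nsmul_eq H (eq_of_card_nsmul_eq L ?_)
  rw [← map_nsmul, card_nsmul_transfer_apply, map_sum, smul_comm, card_nsmul_transfer_apply]
  simp only [map_nsmul]
  rw [nsmul_sum_card_nsmul_eq (fun x : H => (x : G))
    (b := fun K => transferTerm u L K (X.res hL m))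
    fun K => hu.card_nsmul_res_transferTerm hL K m, Nat.card_eq_fintype_card]

theorem card_inf_nsmul_ind_apply_mackeyTerm (hu : IsCuspidal u) (hK : K ≤ H) (hL : L ≤ H) (x : H)
    (m : X.obj L) :
    Nat.card (K ⊓ MulAut.conj (x : G) • L : Subgroup G) •
        E.ind hK (u K (X.mackeyTerm K L x m)) =
      Nat.card K • E.ind hL (transferTerm u L (MulAut.conj (x : G)⁻¹ • K) m) := by
  have eH : H = MulAut.conj (x : G) • H := (Subgroup.conj_smul_eq_self_of_mem x.2).symm
  have eK : K = MulAut.conj (x : G) • MulAut.conj (x : G)⁻¹ • K := by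
    rw [map_inv, smul_inv_smul]
  have le_iff : K ≤ MulAut.conj (x : G) • L ↔ MulAut.conj (x : G)⁻¹ • K ≤ L := by
    rw [map_inv, Subgroup.subset_pointwise_smul_iff]
  by_cases hx : MulAut.conj (x : G)⁻¹ • K ≤ L
  · rw [inf_eq_left.2 (le_iff.2 hx), mackeyTerm_apply_of_le_conj_smul eK hx, ← hu.conj_apply,
      E.ind_conj x (hx.trans hL) hK eK eH, E.conj_self x x.2, transferTerm_apply_of_le hx,
      ← E.ind_trans hx hL (hx.trans hL)]
  · have inf_lt : K ⊓ MulAut.conj (x : G) • L < K := by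
      rw [inf_lt_left, le_iff]
      exact hx
    rw [mackeyTerm, LinearMap.comp_apply, hu.apply_ind inf_lt, transferTerm_of_not_le hx]
    simp only [map_zero, smul_zero, LinearMap.zero_apply]

theorem card_nsmul_transferTerm_ind (hu : IsCuspidal u) (hL : L ≤ H) (K : Subgroup G)
    (m : X.obj L) :
    Nat.card L • transferTerm u H K (X.ind hL m) =
      ∑ x : H, E.ind hL (transferTerm u L (MulAut.conj (x : G)⁻¹ • K) m) := by
  by_cases hK : K ≤ H
  · refine eq_of_card_nsmul_eq K ?_
    rw [smul_smul, transferTerm_apply_of_le hK, ← map_nsmul, ← map_nsmul,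
      card_mul_card_nsmul_res_ind hK hL, map_sum, map_sum, Finset.smul_sum]
    refine Finset.sum_congr rfl fun x _ => ?_
    rw [map_nsmul, map_nsmul, hu.card_inf_nsmul_ind_apply_mackeyTerm hK hL x m]
  · have not_le (x : H) : ¬MulAut.conj (x : G)⁻¹ • K ≤ L := fun h =>
      hK ((conj_smul_le_iff_of_mem (H.inv_mem x.2)).1 (h.trans hL))
    simp only [transferTerm_of_not_le hK, transferTerm_of_not_le (not_le _), LinearMap.zero_apply,
      map_zero, smul_zero, Finset.sum_const_zero]

theorem transfer_ind (hu : IsCuspidal u) (hL : L ≤ H) (m : X.obj L) :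
    transfer u H (X.ind hL m) = E.ind hL (transfer u L m) := by
  refine eq_of_card_nsmul_eq H (eq_of_card_nsmul_eq L ?_)
  rw [card_nsmul_transfer_apply, smul_comm _ (Nat.card H), ← map_nsmul, card_nsmul_transfer_apply,
    map_sum]
  simp only [map_nsmul]
  rw [nsmul_sum_card_nsmul_eq (fun x : H => (x : G)⁻¹)
    (b := fun K => E.ind hL (transferTerm u L K m))
    fun K => hu.card_nsmul_transferTerm_ind hL K m, Nat.card_eq_fintype_card]

/-- The morphism given by the transfer of a cuspidal family. -/
def transferHom (hu : IsCuspidal u) : Hom X E where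
  app := transfer u
  app_res h m := (hu.res_transfer h m).symm
  app_ind h m := hu.transfer_ind h m
  app_conj g _ _ e m := (hu.conj_transfer g e m).symm

theorem transfer_apply (hu : IsCuspidal u) {F : RationalMackeyFunctor.{u, v} G}
    (w : ∀ K, E.obj K →ₗ[ℚ] F.obj K) (m : X.obj H) : transfer w H (u H m) = w H (u H m) :=
  map_transfer_apply_of_forall_lt LinearMap.id fun K hK => by
    rw [hu.res_apply hK, map_zero, map_zero, map_zero]

theorem apply_transfer (hu : IsCuspidal u) {F : RationalMackeyFunctor.{u, v} G}
    (w : ∀ K, F.obj K →ₗ[ℚ] X.obj K) (m : F.obj H) : u H (transfer w H m) = u H (w H m) :=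
  map_transfer_apply_of_forall_lt (u H) fun _ hK => hu.apply_ind hK _

end IsCuspidal

end Transfer

section CuspidalDecomposition

variable {X E : RationalMackeyFunctor.{u, v} G}

theorem isCuspidal_zero : IsCuspidal (0 : ∀ K, X.obj K →ₗ[ℚ] E.obj K) where
  conj_apply _ _ _ _ _ := by simp
  res_apply _ _ := by simp
  apply_ind _ _ := by simp

theorem isCuspidal_sub_of_app_eq {f g : Hom X E} {n : ℕ}
    (h : ∀ J : Subgroup G, Nat.card J < n → f.app J = g.app J) :
    IsCuspidal fun K => if Nat.card K = n then f.app K - g.app K else 0 where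
  conj_apply x K K' e m := by
    have card_eq : Nat.card K' = Nat.card K := by rw [e, card_conj_smul]
    rw [card_eq]
    split_ifs <;> simp [f.app_conj, g.app_conj]
  res_apply {J K} hJK m := by
    split_ifs with hK
    · have app_eq := h J (hK ▸ card_subgroup_lt_card_of_lt hJK)
      rw [LinearMap.sub_apply, map_sub, ← f.app_res, ← g.app_res, app_eq, sub_self]
    · simp
  apply_ind {J K} hJK m := by
    split_ifs with hK
    · have app_eq := h J (hK ▸ card_subgroup_lt_card_of_lt hJK)
      rw [LinearMap.sub_apply, f.app_ind, g.app_ind, app_eq, sub_self]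
    · simp

theorem exists_isCuspidal_transfer_eq_of_card_lt (f : Hom X E) (n : ℕ) :
    ∃ u : ∀ K, X.obj K →ₗ[ℚ] E.obj K, IsCuspidal u ∧
      ∀ H : Subgroup G, Nat.card H < n → transfer u H = f.app H := by
  induction n with
  | zero => exact ⟨0, isCuspidal_zero, fun _ h => absurd h (Nat.not_lt_zero _)⟩
  | succ n ih =>
    obtain ⟨u, hu, transfer_u⟩ := ih
    let d : ∀ K, X.obj K →ₗ[ℚ] E.obj K :=
      fun K => if Nat.card K = n then f.app K - transfer u K else 0
    have hd : IsCuspidal d :=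
      isCuspidal_sub_of_app_eq (g := hu.transferHom) fun J hJ => (transfer_u J hJ).symm
    refine ⟨u + d, hu.add hd, fun H hH => ?_⟩
    have d_of_lt (K : Subgroup G) (hK : K < H) : d K = 0 :=
      if_neg ((card_subgroup_lt_card_of_lt hK).trans_le (Nat.le_of_lt_succ hH)).ne
    have transfer_d : transfer d H = d H := LinearMap.ext fun m =>
      map_transfer_apply_of_forall_lt LinearMap.id fun K hK => by simp [d_of_lt K hK]
    have d_self : d H = f.app H - transfer u H := by
      rcases (Nat.le_of_lt_succ hH).eq_or_lt with hn | hn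
      · exact if_pos hn
      · rw [transfer_u H hn, sub_self]
        exact if_neg hn.ne
    rw [transfer_add, transfer_d, d_self, add_sub_cancel]

theorem exists_isCuspidal_transfer_eq (f : Hom X E) :
    ∃ u : ∀ K, X.obj K →ₗ[ℚ] E.obj K, IsCuspidal u ∧ ∀ H, transfer u H = f.app H := by
  obtain ⟨u, hu, transfer_u⟩ := exists_isCuspidal_transfer_eq_of_card_lt f (Nat.card G + 1)
  exact ⟨u, hu, fun H => transfer_u H (Nat.lt_succ_of_le H.card_le_card_group)⟩

end CuspidalDecomposition

section Average

variable {X E : RationalMackeyFunctor.{u, v} G} {K : Subgroup G}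

theorem conj_inv_conj {M : RationalMackeyFunctor.{u, v} G} {g : G} {H H' : Subgroup G}
    (e : H' = MulAut.conj g • H) (e' : H = MulAut.conj g⁻¹ • H') (m : M.obj H) :
    M.conj g⁻¹ e' (M.conj g e m) = m := by
  have mul_mem : g⁻¹ * g ∈ H := by simp
  rw [← M.conj_mul g⁻¹ g e e' (Subgroup.conj_smul_eq_self_of_mem mul_mem).symm,
    M.conj_self _ mul_mem]

theorem conj_conj_inv {M : RationalMackeyFunctor.{u, v} G} {g : G} {H H' : Subgroup G}
    (e : H' = MulAut.conj g • H) (e' : H = MulAut.conj g⁻¹ • H') (m : M.obj H') :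
    M.conj g e (M.conj g⁻¹ e' m) = m := by
  have mul_mem : g * g⁻¹ ∈ H' := by simp
  rw [← M.conj_mul g g⁻¹ e' e (Subgroup.conj_smul_eq_self_of_mem mul_mem).symm,
    M.conj_self _ mul_mem]

/-- The conjugate `C_g⁻¹ ∘ s ∘ C_g` of a family `s` of linear maps. -/
def conjFamily (g : G) (s : ∀ K, X.obj K →ₗ[ℚ] E.obj K) (K : Subgroup G) :
    X.obj K →ₗ[ℚ] E.obj K :=
  E.conj g⁻¹ (by rw [map_inv, inv_smul_smul]) ∘ₗ s (MulAut.conj g • K) ∘ₗ X.conj g rfl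

/-- The average of the conjugates of a family of linear maps. -/
def average (s : ∀ K, X.obj K →ₗ[ℚ] E.obj K) (K : Subgroup G) : X.obj K →ₗ[ℚ] E.obj K :=
  (Nat.card G : ℚ)⁻¹ • ∑ g : G, conjFamily g s K

variable {s : ∀ K, X.obj K →ₗ[ℚ] E.obj K}

theorem conjFamily_apply_of_eq {g : G} {L : Subgroup G} (e : L = MulAut.conj g • K)
    (e' : K = MulAut.conj g⁻¹ • L) (m : X.obj K) :
    conjFamily g s K m = E.conj g⁻¹ e' (s L (X.conj g e m)) := by
  subst e
  rfl

theorem conj_conjFamily_mul (g x : G) {K' : Subgroup G} (e : K' = MulAut.conj g • K)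
    (m : X.obj K) :
    E.conj g e (conjFamily (x * g) s K m) = conjFamily x s K' (X.conj g e m) := by
  have eK : K = MulAut.conj g⁻¹ • K' := by rw [e, map_inv, inv_smul_smul]
  have eL : MulAut.conj x • K' = MulAut.conj (x * g) • K := by rw [e, map_mul, mul_smul]
  have eK' : K' = MulAut.conj x⁻¹ • MulAut.conj x • K' := by rw [map_inv, inv_smul_smul]
  have eL' : K = MulAut.conj (x * g)⁻¹ • MulAut.conj x • K' := by
    rw [eL, map_inv, inv_smul_smul]
  have conj_mul_inv (n : E.obj (MulAut.conj x • K')) :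
      E.conj (x * g)⁻¹ eL' n = E.conj g⁻¹ eK (E.conj x⁻¹ eK' n) := by
    simp only [mul_inv_rev]
    exact E.conj_mul g⁻¹ x⁻¹ eK' eK _ n
  rw [conjFamily_apply_of_eq eL eL', X.conj_mul x g e rfl eL, conj_mul_inv, conj_conj_inv]
  rfl

theorem isEquivariant_average (s : ∀ K, X.obj K →ₗ[ℚ] E.obj K) : IsEquivariant (average s) where
  conj_apply g K K' e m := by
    simp only [average, LinearMap.smul_apply, LinearMap.sum_apply, map_smul, map_sum]
    rw [← Equiv.sum_comp (Equiv.mulRight g)]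
    simp only [Equiv.coe_mulRight, conj_conjFamily_mul]

theorem IsEquivariant.apply_conjFamily_apply {a : ∀ K, E.obj K →ₗ[ℚ] X.obj K}
    (ha : IsEquivariant a) (hs : ∀ K, a K ∘ₗ s K ∘ₗ a K = a K) (g : G) (m : E.obj K) :
    a K (conjFamily g s K (a K m)) = a K m := by
  have a_s_a (n : E.obj (MulAut.conj g • K)) : a _ (s _ (a _ n)) = a _ n :=
    LinearMap.congr_fun (hs _) n
  simp only [conjFamily, LinearMap.comp_apply]
  rw [ha.conj_apply, ← ha.conj_apply g⁻¹, a_s_a, ← ha.conj_apply, conj_inv_conj]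

theorem IsEquivariant.apply_average_apply {a : ∀ K, E.obj K →ₗ[ℚ] X.obj K}
    (ha : IsEquivariant a) (hs : ∀ K, a K ∘ₗ s K ∘ₗ a K = a K) (m : E.obj K) :
    a K (average s K (a K m)) = a K m := by
  have card_ne_zero : (Nat.card G : ℚ) ≠ 0 := by exact_mod_cast Nat.card_pos.ne'
  rw [average, LinearMap.smul_apply, LinearMap.sum_apply, map_smul, map_sum,
    inv_smul_eq_iff₀ card_ne_zero]
  simp only [ha.apply_conjFamily_apply hs, Finset.sum_const, Finset.card_univ,
    ← Nat.card_eq_fintype_card, Nat.cast_smul_eq_nsmul]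

theorem IsCuspidal.comp_isEquivariant_comp {X' E' : RationalMackeyFunctor.{u, v} G}
    {p : ∀ K, E.obj K →ₗ[ℚ] E'.obj K} {t : ∀ K, X.obj K →ₗ[ℚ] E.obj K}
    {r : ∀ K, X'.obj K →ₗ[ℚ] X.obj K} (hp : IsCuspidal p) (ht : IsEquivariant t)
    (hr : IsCuspidal r) : IsCuspidal fun K => p K ∘ₗ t K ∘ₗ r K where
  conj_apply g _ _ e m := by
    simp only [LinearMap.comp_apply, hp.conj_apply, ht.conj_apply, hr.conj_apply]
  res_apply h m := hp.res_apply h _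
  apply_ind h m := by simp only [LinearMap.comp_apply, hr.apply_ind h, map_zero]

end Average

theorem exists_comp_comp_eq_self {E X : RationalMackeyFunctor.{u, v} G} (f : E ⟶ X) :
    ∃ s : X ⟶ E, f ≫ s ≫ f = f := by
  change Hom E X at f
  obtain ⟨a, ha, transfer_a⟩ := exists_isCuspidal_transfer_eq f
  obtain ⟨p, hp, transfer_p⟩ := exists_isCuspidal_transfer_eq (𝟙 E : Hom E E)
  obtain ⟨r, hr, transfer_r⟩ := exists_isCuspidal_transfer_eq (𝟙 X : Hom X X)
  choose s hs using fun K => exists_linearMap_comp_comp_eq_self (a K)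
  have hw := hp.comp_isEquivariant_comp (isEquivariant_average s) hr
  refine ⟨hw.transferHom, Hom.ext (funext fun H => LinearMap.ext fun m => ?_)⟩
  have f_p (K : Subgroup G) (n : E.obj K) : f.app K (p K n) = a K n :=
    calc f.app K (p K n) = a K (p K n) := by rw [← transfer_a, hp.transfer_apply]
      _ = a K (transfer p K n) := (ha.apply_transfer p n).symm
      _ = a K n := by rw [transfer_p]; rfl
  have r_f (K : Subgroup G) (n : E.obj K) : r K (f.app K n) = a K n :=
    calc r K (f.app K n) = r K (a K n) := by rw [← transfer_a, hr.apply_transfer]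
      _ = transfer r K (a K n) := (ha.transfer_apply r n).symm
      _ = a K n := by rw [transfer_r]; rfl
  have f_w_f (K : Subgroup G) : f.app K ∘ₗ (p K ∘ₗ average s K ∘ₗ r K) ∘ₗ f.app K = a K :=
    LinearMap.ext fun n => by
      simp only [LinearMap.comp_apply, r_f, f_p, ha.apply_average_apply hs]
  calc f.app H (transfer _ H (f.app H m)) = transfer a H m := by
        simp only [app_transfer_app, f_w_f]
    _ = f.app H m := by rw [transfer_a]

end

end RationalMackeyFunctor

theorem mainTheorem5 {G : Type u} [Group G] [Finite G] (M : RationalMackeyFunctor.{u, v} G) :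
    CategoryTheory.Projective M ∧ CategoryTheory.Injective M :=
  ⟨projective_of_forall_exists_comp_comp_eq_self RationalMackeyFunctor.exists_comp_comp_eq_self M,
    injective_of_forall_exists_comp_comp_eq_self RationalMackeyFunctor.exists_comp_comp_eq_self M⟩
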